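/- Let $X_n$ ($n = 1, 2, \dots$) and $X$ be real-valued random variables, possibly defined on different probability spaces. Suppose that for every $n$: 1. $X_n$ has the same distribution as $-X_n$, and 2. $\mathbb{E}\left[\exp\left(b_n X_n^2\right)\right] < \infty$ for some $b_n > 0$ (which may depend on $n$). If $X_n$ converges in distribution to $X$ and $\mathbb{E}\left[\exp\left(b X^2\right)\right] = \infty$ for all $b > 0$, then for all but finitely many $n$ the moment generating function $z \mapsto \mathbb{E}\left[\exp\left(z X_n\right)\right]$, $z \in \mathbb{C}$, has some zeros that are not purely imaginary; that is, there is $z \in \mathbb{C}$ with $\operatorname{Re} z \neq 0$ such that $\exp(zX_n)$ is integrable and $\mathbb{E}\left[\exp\left(z X_n\right)\right] = 0$. -/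

import Mathlib

open MeasureTheory ProbabilityTheory Filter

/-! Suppose that infinitely many `X n` have only imaginary zeros. Each such transform f is even,
entire and of order at most two, so heuristically Hadamard gives f(z) = exp(αz²) ∏ (1 + c z²) with c
> 0. Since log(1 + ct²)/t² decreases, so does log f(t)/t² for t > 0
(`norm_le_rpow_of_imaginary_zeros`), and the value at one point s bounds f by a Gaussian beyond s.
Tightness yields an s with f(s) ≤ 2 that serves all large n (`mgf_le_two_of_tail_lt`). Integrating
the resulting bound against a Gaussian weight bounds E exp(b `X n`²) uniformly, for one fixed b > 0
(`lintegral_exp_sq_le_of_mgf_le`). A Fatou inequality for weak convergence carries the bound to the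
limit, a contradiction. Hadamard's theorem is replaced by a version on discs: the zeros in a disc of
radius R are divided out, the remaining factor is exp(z² K z) there, and K is constant up to O(1/R)
at fixed points. -/

/-! ### Dividing out the zeros in a disc -/

theorem exists_eq_sub_mul_of_differentiable {f : ℂ → ℂ} (hf : Differentiable ℂ f) {w : ℂ}
    (hw : f w = 0) : ∃ g : ℂ → ℂ, Differentiable ℂ g ∧ ∀ z, f z = (z - w) * g z := by
  refine ⟨dslope f w, ?_, fun z => ?_⟩
  · rw [← differentiableOn_univ]
    exact (Complex.differentiableOn_dslope univ_mem).2 hf.differentiableOn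
  · simpa [hw] using (sub_smul_dslope f w z).symm

/-- An even entire function with a zero at `w` is divisible by `1 - z² / w²`
within even entire functions. -/
theorem exists_even_eq_mul_of_zero {f : ℂ → ℂ} (hf : Differentiable ℂ f)
    (heven : ∀ z, f (-z) = f z) {w : ℂ} (hw0 : w ≠ 0) (hw : f w = 0) :
    ∃ g : ℂ → ℂ, Differentiable ℂ g ∧ (∀ z, g (-z) = g z) ∧
      ∀ z, f z = (1 - z ^ 2 / w ^ 2) * g z := by
  obtain ⟨g₁, hg₁, h₁⟩ := exists_eq_sub_mul_of_differentiable hf hw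
  have hg₁w : g₁ (-w) = 0 := by
    have h : f (-w) = 0 := by rw [heven, hw]
    rw [h₁] at h
    rcases mul_eq_zero.1 h with h | h
    · exact absurd (by linear_combination (-1 / 2 : ℂ) * h) hw0
    · exact h
  obtain ⟨g₂, hg₂, h₂⟩ := exists_eq_sub_mul_of_differentiable hg₁ hg₁w
  -- Averaging over ±z makes the quotient even by construction, also at ±w, where the vanishing
  -- factor cannot be cancelled.
  refine ⟨fun z => -w ^ 2 * ((g₂ z + g₂ (-z)) / 2), by fun_prop, fun z => by
    simp only [neg_neg]; ring, fun z => ?_⟩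
  have e₁ : f z = (z ^ 2 - w ^ 2) * g₂ z := by rw [h₁, h₂]; ring
  have e₂ : f z = (z ^ 2 - w ^ 2) * g₂ (-z) := by rw [← heven, h₁, h₂]; ring
  have : (1 - z ^ 2 / w ^ 2) * (-w ^ 2) = z ^ 2 - w ^ 2 := by field_simp; ring
  rw [← mul_assoc, this]
  linear_combination e₁ / 2 + e₂ / 2

theorem norm_le_of_sphere {f : ℂ → ℂ} {r C : ℝ} (hr : 0 < r)
    (hf : DifferentiableOn ℂ f (Metric.closedBall 0 r))
    (hC : ∀ z, ‖z‖ = r → ‖f z‖ ≤ C) {z : ℂ} (hz : ‖z‖ ≤ r) : ‖f z‖ ≤ C := by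
  refine Complex.norm_le_of_forall_mem_frontier_norm_le (U := Metric.ball 0 r)
    Metric.isBounded_ball (hf.diffContOnCl_ball subset_rfl) (fun z hz => hC z ?_) ?_
  · simpa [frontier_ball _ hr.ne'] using hz
  · simpa [closure_ball _ hr.ne'] using hz

/-- On the circle of radius 2R every |c z²| is at least 4. Dividing by the factors therefore shrinks
a bound there, which the maximum principle takes to the interior. -/
theorem three_pow_length_le_norm_prod {R : ℝ} (hR : 0 < R) {L : List ℝ}
    (hL : ∀ c ∈ L, 1 / R ^ 2 ≤ c) {z : ℂ} (hz : ‖z‖ = 2 * R) :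
    3 ^ L.length ≤ ‖(L.map fun c : ℝ => 1 + (c : ℂ) * z ^ 2).prod‖ := by
  induction L with
  | nil => simp
  | cons c L ih =>
    have hc := hL c (by simp)
    have ih := ih fun c hc => hL c (by simp [hc])
    have hc0 : 0 ≤ c := le_trans (by positivity) hc
    have h3 : 3 ≤ ‖1 + (c : ℂ) * z ^ 2‖ := by
      have h1 : ‖(c : ℂ) * z ^ 2‖ = c * (4 * R ^ 2) := by
        rw [norm_mul, norm_pow, hz, Complex.norm_real, Real.norm_of_nonneg hc0]; ring
      have h2 : ‖(c : ℂ) * z ^ 2‖ ≤ ‖1 + (c : ℂ) * z ^ 2‖ + 1 := by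
        have h := norm_sub_le (1 + (c : ℂ) * z ^ 2) 1
        rwa [add_sub_cancel_left, norm_one] at h
      have h4 : 1 ≤ c * R ^ 2 := by rwa [div_le_iff₀ (by positivity)] at hc
      linarith
    simp only [List.length_cons, List.map_cons, List.prod_cons, norm_mul, pow_succ' (3 : ℝ)]
    gcongr

/-- Extraction of the zeros in a disc of an even entire function with purely imaginary zeros. -/
theorem exists_prod_mul_zero_free {f : ℂ → ℂ} (hf : Differentiable ℂ f)
    (heven : ∀ z, f (-z) = f z) (hf0 : f 0 = 1) (hzero : ∀ z, f z = 0 → z.re = 0)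
    {R : ℝ} (hR : 0 < R) :
    ∃ (L : List ℝ) (q : ℂ → ℂ), (∀ c ∈ L, 1 / R ^ 2 ≤ c) ∧ Differentiable ℂ q ∧
      (∀ z, q (-z) = q z) ∧ (∀ z, f z = (L.map fun c : ℝ => 1 + (c : ℂ) * z ^ 2).prod * q z) ∧
      ∀ z, ‖z‖ < R → q z ≠ 0 := by
  by_contra! hcon
  -- If the extraction never ended, k factors could be split off for every k; then 1 = |q 0| ≤ C / 3
  -- ^ k, which is absurd for large k.
  have key : ∀ k : ℕ, ∃ (L : List ℝ) (q : ℂ → ℂ), L.length = k ∧ (∀ c ∈ L, 1 / R ^ 2 ≤ c) ∧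
      Differentiable ℂ q ∧ (∀ z, q (-z) = q z) ∧
      ∀ z, f z = (L.map fun c : ℝ => 1 + (c : ℂ) * z ^ 2).prod * q z := by
    intro k
    induction k with
    | zero => exact ⟨[], f, rfl, by simp, hf, heven, by simp⟩
    | succ k ih =>
      obtain ⟨L, q, hk, hL, hq, hqe, hfq⟩ := ih
      obtain ⟨w, hwR, hw⟩ := hcon L q hL hq hqe hfq
      have hfw : f w = 0 := by rw [hfq, hw, mul_zero]
      have hw0 : w ≠ 0 := by rintro rfl; simp [hf0] at hfw
      obtain ⟨g, hg, hge, hqg⟩ := exists_even_eq_mul_of_zero hq hqe hw0 hw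
      have hwI : w = w.im * Complex.I := by
        apply Complex.ext <;> simp [hzero w hfw]
      have him : w.im ≠ 0 := fun h => hw0 (by rw [hwI, h]; simp)
      have him' : (w.im : ℂ) ≠ 0 := by exact_mod_cast him
      have hw2 : w ^ 2 = -(w.im : ℂ) ^ 2 := by
        conv_lhs => rw [hwI]
        rw [mul_pow, Complex.I_sq]; ring
      refine ⟨(1 / w.im ^ 2) :: L, g, by simp [hk], ?_, hg, hge, fun z => ?_⟩
      · intro c hc
        rcases List.mem_cons.1 hc with rfl | hc
        · have : |w.im| < R := (Complex.abs_im_le_norm w).trans_lt hwR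
          have h2 : w.im ^ 2 ≤ R ^ 2 := sq_le_sq.2 (by rw [abs_of_pos hR]; exact this.le)
          have : 0 < w.im ^ 2 := by positivity
          gcongr
        · exact hL c hc
      · rw [hfq, hqg, hw2, List.map_cons, List.prod_cons]
        have h : 1 - z ^ 2 / -(w.im : ℂ) ^ 2 = 1 + ((1 / w.im ^ 2 : ℝ) : ℂ) * z ^ 2 := by
          push_cast
          field_simp
          ring
        rw [h]
        ring
  obtain ⟨C, hC⟩ := (isCompact_sphere (0 : ℂ) (2 * R)).exists_bound_of_continuousOn
    hf.continuous.continuousOn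
  obtain ⟨k, hk⟩ := pow_unbounded_of_one_lt C (by norm_num : (1 : ℝ) < 3)
  obtain ⟨L, q, hLk, hL, hq, -, hfq⟩ := key k
  have hq0 : q 0 = 1 := by
    have := hfq 0
    simpa [hf0] using this.symm
  have hqC : ‖q 0‖ ≤ C / 3 ^ k := by
    refine norm_le_of_sphere (r := 2 * R) (by positivity) hq.differentiableOn (fun z hz => ?_)
      (by simp; positivity)
    have h1 := hC z (by simpa using hz)
    have h2 := three_pow_length_le_norm_prod hR hL hz
    rw [hfq, norm_mul] at h1
    rw [hLk] at h2
    rw [le_div_iff₀ (by positivity), mul_comm]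
    exact (mul_le_mul_of_nonneg_right h2 (norm_nonneg _)).trans h1
  rw [hq0, norm_one, le_div_iff₀ (by positivity)] at hqC
  linarith

/-! ### The logarithm of the zero-free factor -/

theorem exists_log_of_ball {q : ℂ → ℂ} (hq : Differentiable ℂ q) (hq0 : q 0 = 1) {R : ℝ}
    (hR : 0 < R) (hne : ∀ z, ‖z‖ < R → q z ≠ 0) :
    ∃ H : ℂ → ℂ, H 0 = 0 ∧ (∀ z ∈ Metric.ball (0 : ℂ) R, HasDerivAt H (deriv q z / q z) z) ∧
      ∀ z ∈ Metric.ball (0 : ℂ) R, q z = Complex.exp (H z) := by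
  have hne' : ∀ z ∈ Metric.ball (0 : ℂ) R, q z ≠ 0 := fun z hz => hne z (by simpa using hz)
  have hd : DifferentiableOn ℂ (fun z => deriv q z / q z) (Metric.ball 0 R) :=
    hq.deriv.differentiableOn.div hq.differentiableOn hne'
  obtain ⟨G, hG⟩ := hd.isExactOn_ball
  have hder : ∀ z ∈ Metric.ball (0 : ℂ) R,
      HasDerivAt (fun z => G z - G 0) (deriv q z / q z) z := fun z hz => (hG z hz).sub_const _
  refine ⟨fun z => G z - G 0, by simp, hder, fun z hz => ?_⟩
  have hder2 : ∀ z ∈ Metric.ball (0 : ℂ) R,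
      HasDerivAt (fun z => q z * Complex.exp (-(G z - G 0))) 0 z := fun z hz => by
    have := (hq z).hasDerivAt.mul ((hder z hz).neg.cexp)
    convert! this using 1
    have := hne' z hz
    field_simp
    ring
  have hconst := (convex_ball (0 : ℂ) R).is_const_of_fderivWithin_eq_zero (𝕜 := ℂ)
    (f := fun z => q z * Complex.exp (-(G z - G 0)))
    (fun z hz => (hder2 z hz).differentiableAt.differentiableWithinAt)
    (fun z hz => by
      rw [((hder2 z hz).hasFDerivAt.hasFDerivWithinAt).fderivWithin
        (Metric.isOpen_ball.uniqueDiffWithinAt hz)]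
      ext; simp) hz (Metric.mem_ball_self hR)
  simp only [sub_self, neg_zero, Complex.exp_zero, hq0, mul_one] at hconst
  rw [Complex.exp_neg] at hconst
  field_simp at hconst
  exact hconst

/-- A normalised even entire function without zeros in a disc is there `exp (z² K z)`, and `K`
is nearly constant if the function does not grow too fast. -/
theorem exists_exp_sq_mul_of_zero_free {q : ℂ → ℂ} (hq : Differentiable ℂ q)
    (heven : ∀ z, q (-z) = q z) (hq0 : q 0 = 1) {R B : ℝ} (hR : 0 < R) (hB : 0 < B)
    (hne : ∀ z, ‖z‖ < R → q z ≠ 0) (hbd : ∀ z, ‖z‖ < R → ‖q z‖ ≤ Real.exp (B * R ^ 2)) :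
    ∃ K : ℂ → ℂ, (∀ z, ‖z‖ < R → q z = Complex.exp (z ^ 2 * K z)) ∧
      ∀ z, ‖z‖ < R / 2 → ‖K z - K 0‖ ≤ 32 * B * ‖z‖ / R := by
  obtain ⟨H, H0, hder, hexp⟩ := exists_log_of_ball hq hq0 hR hne
  have hHd : DifferentiableOn ℂ H (Metric.ball 0 R) := fun z hz =>
    (hder z hz).differentiableAt.differentiableWithinAt
  have h0R : (0 : ℂ) ∈ Metric.ball (0 : ℂ) R := Metric.mem_ball_self hR
  -- Evenness removes the linear term of the logarithm H, so that z² divides H.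
  have hq' : deriv q 0 = 0 := by
    have h1 : HasDerivAt q (deriv q 0) (-0) := by simpa using (hq 0).hasDerivAt
    have h2 := h1.comp (0 : ℂ) (hasDerivAt_neg (0 : ℂ))
    have h3 : q ∘ Neg.neg = q := funext fun z => heven z
    rw [h3] at h2
    have := h2.unique (hq 0).hasDerivAt
    linear_combination (-1 / 2 : ℂ) * this
  have H0' : deriv H 0 = 0 := by rw [(hder 0 h0R).deriv, hq', zero_div]
  have hd1 : DifferentiableOn ℂ (dslope H 0) (Metric.ball 0 R) :=
    (Complex.differentiableOn_dslope (Metric.ball_mem_nhds 0 hR)).2 hHd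
  have hKd : DifferentiableOn ℂ (dslope (dslope H 0) 0) (Metric.ball 0 R) :=
    (Complex.differentiableOn_dslope (Metric.ball_mem_nhds 0 hR)).2 hd1
  have hHK : ∀ z, H z = z ^ 2 * dslope (dslope H 0) 0 z := fun z => by
    have h1 := sub_smul_dslope H 0 z
    have h2 := sub_smul_dslope (dslope H 0) 0 z
    simp only [sub_zero, smul_eq_mul, H0, dslope_same, H0'] at h1 h2
    rw [pow_two, mul_assoc, h2, h1]
  have hHre : Set.MapsTo H (Metric.ball 0 R) {z | z.re ≤ B * R ^ 2} := fun z hz => by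
    have := hbd z (by simpa using hz)
    rwa [hexp z hz, Complex.norm_exp, Real.exp_le_exp] at this
  have hsub : Metric.closedBall (0 : ℂ) (R / 2) ⊆ Metric.ball 0 R :=
    Metric.closedBall_subset_ball (by linarith)
  -- Borel–Carathéodory gives |H| ≤ 2BR² on the circle of radius R/2; dividing by (R/2)² leaves 8B.
  have hKbd : ∀ z : ℂ, ‖z‖ ≤ R / 2 → ‖dslope (dslope H 0) 0 z‖ ≤ 8 * B := fun z hz => by
    refine norm_le_of_sphere (by positivity) (hKd.mono hsub) (fun z hz => ?_) hz
    have h := Complex.borelCaratheodory_zero (by positivity) hHd hHre hR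
      (hsub (mem_closedBall_zero_iff.2 hz.le)) H0
    rw [hHK, norm_mul, norm_pow, hz] at h
    have : 2 * (B * R ^ 2) * (R / 2) / (R - R / 2) = (R / 2) ^ 2 * (8 * B) := by
      field_simp; ring
    rw [this] at h
    exact le_of_mul_le_mul_left h (by positivity)
  refine ⟨dslope (dslope H 0) 0, fun z hz => ?_, fun z hz => ?_⟩
  · rw [hexp z (by simpa using hz), ← hHK]
  -- Schwarz lemma: K stays within 8B + 8B of K 0 on the disc of radius R/2.
  · have := Complex.dist_le_div_mul_dist_of_mapsTo_ball (R₁ := R / 2) (R₂ := 16 * B)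
      (hKd.mono (Metric.ball_subset_closedBall.trans hsub)) (fun w hw => ?_)
      (show z ∈ Metric.ball (0 : ℂ) (R / 2) by simpa using hz)
    · rw [dist_eq_norm, dist_zero_right] at this
      refine this.trans_eq ?_
      field_simp
      ring
    · rw [Metric.mem_closedBall, dist_eq_norm]
      have h1 := hKbd w (by simpa using (Metric.mem_ball.1 hw).le)
      have h2 := hKbd 0 (by simp; positivity)
      linarith [norm_sub_le (dslope (dslope H 0) 0 w) (dslope (dslope H 0) 0 0)]

/-! ### Monotonicity of log f(t) / t² -/

/-- Bernoulli's inequality 1 + px ≤ (1 + x)^p for each factor, with x = cs² and p = t²/s² ≥ 1. -/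
theorem norm_prod_le_rpow {L : List ℝ} (hL : ∀ c ∈ L, 0 ≤ c) {s t : ℝ} (hs : 0 < s)
    (hst : s ≤ t) :
    ‖(L.map fun c : ℝ => 1 + (c : ℂ) * (t : ℂ) ^ 2).prod‖ ≤
      ‖(L.map fun c : ℝ => 1 + (c : ℂ) * (s : ℂ) ^ 2).prod‖ ^ (t ^ 2 / s ^ 2) := by
  induction L with
  | nil => simp
  | cons c L ih =>
    have hc := hL c (by simp)
    have ih := ih fun c hc => hL c (by simp [hc])
    have hn : ∀ u : ℝ, ‖1 + (c : ℂ) * (u : ℂ) ^ 2‖ = 1 + c * u ^ 2 := fun u => by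
      have : (1 + (c : ℂ) * (u : ℂ) ^ 2) = ((1 + c * u ^ 2 : ℝ) : ℂ) := by push_cast; ring
      rw [this, Complex.norm_real, Real.norm_of_nonneg (by positivity)]
    simp only [List.map_cons, List.prod_cons, norm_mul, hn]
    rw [Real.mul_rpow (by positivity) (norm_nonneg _)]
    have hp : 1 ≤ t ^ 2 / s ^ 2 := by
      rw [one_le_div (by positivity)]; gcongr
    have hb := one_add_mul_self_le_rpow_one_add (s := c * s ^ 2)
      (by linarith [show 0 ≤ c * s ^ 2 by positivity]) hp
    have he : t ^ 2 / s ^ 2 * (c * s ^ 2) = c * t ^ 2 := by field_simp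
    rw [he] at hb
    gcongr

/-- For an even entire function of order two, normalised and with purely imaginary zeros,
`log ‖f t‖ / t ^ 2` is nonincreasing in `t > 0`. -/
theorem norm_le_rpow_of_imaginary_zeros {f : ℂ → ℂ} (hf : Differentiable ℂ f)
    (heven : ∀ z, f (-z) = f z) (hf0 : f 0 = 1) (hzero : ∀ z, f z = 0 → z.re = 0)
    {B : ℝ} (hB : 0 < B) (hbd : ∀ R : ℝ, 1 ≤ R → ∀ z, ‖z‖ = 2 * R → ‖f z‖ ≤ Real.exp (B * R ^ 2))
    {s t : ℝ} (hs : 0 < s) (hst : s ≤ t) :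
    ‖f t‖ ≤ ‖f s‖ ^ (t ^ 2 / s ^ 2) := by
  have ht : 0 < t := hs.trans_le hst
  -- The last factor is the cost of K not being constant; it tends to 1 as R grows.
  have key : ∀ R : ℝ, max 1 (2 * t) < R →
      ‖f t‖ ≤ ‖f s‖ ^ (t ^ 2 / s ^ 2) * Real.exp (t ^ 2 * (64 * B * t / R)) := by
    intro R hR
    have hR1 : 1 ≤ R := (le_max_left _ _).trans hR.le
    have hRt : 2 * t < R := (le_max_right _ _).trans_lt hR
    have hR0 : 0 < R := by linarith
    obtain ⟨L, q, hL, hq, hqe, hfq, hne⟩ := exists_prod_mul_zero_free hf heven hf0 hzero hR0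
    have hq0 : q 0 = 1 := by simpa [hf0] using (hfq 0).symm
    have hqbd : ∀ z, ‖z‖ < R → ‖q z‖ ≤ Real.exp (B * R ^ 2) := fun z hz => by
      refine norm_le_of_sphere (r := 2 * R) (by positivity) hq.differentiableOn (fun z hz => ?_)
        (by linarith)
      have h1 := hbd R hR1 z hz
      have h2 := three_pow_length_le_norm_prod hR0 hL hz
      rw [hfq, norm_mul] at h1
      have h3 : (1 : ℝ) ≤ 3 ^ L.length := one_le_pow₀ (by norm_num)
      exact (le_mul_of_one_le_left (norm_nonneg _) (h3.trans h2)).trans h1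
    obtain ⟨K, hqK, hK⟩ := exists_exp_sq_mul_of_zero_free hq hqe hq0 hR0 hB hne hqbd
    have hnt : ‖(t : ℂ)‖ = t := by simp [ht.le]
    have hns : ‖(s : ℂ)‖ = s := by simp [hs.le]
    have hqn : ∀ u : ℝ, 0 ≤ u → u < R → ‖q u‖ = Real.exp (u ^ 2 * (K u).re) := fun u hu huR => by
      rw [hqK u (by simpa [abs_of_nonneg hu] using huR), Complex.norm_exp]
      norm_cast
      rw [Complex.re_ofReal_mul]
    have hKK : (K t).re ≤ (K s).re + 64 * B * t / R := by
      have h1 := hK t (by rw [hnt]; linarith)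
      have h2 := hK s (by rw [hns]; linarith)
      rw [hnt] at h1
      rw [hns] at h2
      have h3 : ‖K t - K s‖ ≤ 32 * B * t / R + 32 * B * s / R := by
        have := norm_sub_le (K t - K 0) (K s - K 0)
        rw [sub_sub_sub_cancel_right] at this
        linarith
      have h4 := (Complex.re_le_norm (K t - K s)).trans h3
      have h5 : 32 * B * s / R ≤ 32 * B * t / R := by gcongr
      rw [Complex.sub_re] at h4
      have h6 : 64 * B * t / R = 32 * B * t / R + 32 * B * t / R := by ring
      linarith
    rw [hfq t, hfq s, norm_mul, norm_mul, Real.mul_rpow (norm_nonneg _) (norm_nonneg _),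
      hqn t ht.le (by linarith), hqn s hs.le (by linarith), ← Real.exp_mul, mul_assoc,
      ← Real.exp_add]
    refine mul_le_mul (norm_prod_le_rpow (fun c hc => le_trans (by positivity) (hL c hc)) hs hst)
      (Real.exp_le_exp.2 ?_) (Real.exp_pos _).le (by positivity)
    have : s ^ 2 * (K s).re * (t ^ 2 / s ^ 2) = t ^ 2 * (K s).re := by field_simp
    rw [this, ← mul_add]
    gcongr
  have hlim : Tendsto (fun R : ℝ => ‖f s‖ ^ (t ^ 2 / s ^ 2) *
      Real.exp (t ^ 2 * (64 * B * t / R))) atTop (nhds (‖f s‖ ^ (t ^ 2 / s ^ 2) * Real.exp (t ^ 2 * 0))) :=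
    (((tendsto_const_nhds.div_atTop tendsto_id).const_mul _).rexp).const_mul _
  simp only [mul_zero, Real.exp_zero, mul_one] at hlim
  exact ge_of_tendsto hlim ((eventually_gt_atTop _).mono key)

/-! ### Moment generating functions of symmetric variables -/

section Mgf

variable {Ω : Type*} [MeasurableSpace Ω] {P : Measure Ω} {X : Ω → ℝ}

theorem mul_le_sq_add_mul_sq {b : ℝ} (hb : 0 < b) (t x : ℝ) :
    t * x ≤ t ^ 2 / (4 * b) + b * x ^ 2 := by
  have : t ^ 2 / (4 * b) + b * x ^ 2 - t * x = (t - 2 * b * x) ^ 2 / (4 * b) := by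
    field_simp; ring
  have h : 0 ≤ (t - 2 * b * x) ^ 2 / (4 * b) := by positivity
  linarith

theorem integrable_exp_mul_sq_of_lintegral_lt_top (hX : AEMeasurable X P) {b : ℝ}
    (h : ∫⁻ ω, ENNReal.ofReal (Real.exp (b * X ω ^ 2)) ∂P < ⊤) :
    Integrable (fun ω => Real.exp (b * X ω ^ 2)) P :=
  ⟨(Real.measurable_exp.comp_aemeasurable ((hX.pow_const 2).const_mul b)).aestronglyMeasurable,
    (hasFiniteIntegral_iff_ofReal (ae_of_all _ fun _ => (Real.exp_pos _).le)).2 h⟩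

theorem integrable_exp_mul_of_integrable_exp_mul_sq (hX : AEMeasurable X P) {b : ℝ} (hb : 0 < b)
    (h : Integrable (fun ω => Real.exp (b * X ω ^ 2)) P) (t : ℝ) :
    Integrable (fun ω => Real.exp (t * X ω)) P := by
  refine (h.const_mul (Real.exp (t ^ 2 / (4 * b)))).mono'
    (Real.measurable_exp.comp_aemeasurable (hX.const_mul t)).aestronglyMeasurable
    (ae_of_all _ fun ω => ?_)
  rw [Real.norm_of_nonneg (Real.exp_pos _).le, ← Real.exp_add, Real.exp_le_exp]
  exact mul_le_sq_add_mul_sq hb _ _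

theorem mgf_le_exp_sq_mul_integral (hX : AEMeasurable X P) {b : ℝ} (hb : 0 < b)
    (h : Integrable (fun ω => Real.exp (b * X ω ^ 2)) P) (t : ℝ) :
    mgf X P t ≤ Real.exp (t ^ 2 / (4 * b)) * ∫ ω, Real.exp (b * X ω ^ 2) ∂P := by
  rw [mgf, ← integral_const_mul]
  refine integral_mono (integrable_exp_mul_of_integrable_exp_mul_sq hX hb h t)
    (h.const_mul _) fun ω => ?_
  simp only
  rw [← Real.exp_add, Real.exp_le_exp]
  exact mul_le_sq_add_mul_sq hb _ _

theorem differentiable_complexMGF (h : ∀ t, Integrable (fun ω => Real.exp (t * X ω)) P) :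
    Differentiable ℂ (complexMGF X P) := by
  have hu : integrableExpSet X P = Set.univ := Set.eq_univ_of_forall h
  rw [← differentiableOn_univ]
  simpa [hu] using differentiableOn_complexMGF (X := X) (μ := P)

theorem complexMGF_neg_of_symm (hsymm : IdentDistrib X (-X) P P) (z : ℂ) :
    complexMGF X P (-z) = complexMGF X P z := by
  conv_rhs => rw [complexMGF_congr_identDistrib hsymm]
  simp [complexMGF]

theorem integrable_cexp_mul (hX : AEMeasurable X P)
    (h : ∀ t, Integrable (fun ω => Real.exp (t * X ω)) P) (z : ℂ) :
    Integrable (fun ω => Complex.exp (z * (X ω : ℂ))) P := by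
  refine (h z.re).mono' (Complex.measurable_exp.comp_aemeasurable
    ((Complex.measurable_ofReal.comp_aemeasurable hX).const_mul z)).aestronglyMeasurable
    (ae_of_all _ fun ω => ?_)
  simp [Complex.norm_exp]

/-- If the moment generating function of a symmetric random variable has only imaginary zeros,
then `log (mgf X P t) / t ^ 2` is nonincreasing in `t > 0`. -/
theorem mgf_le_rpow_of_imaginary_zeros [IsProbabilityMeasure P]
    (hsymm : IdentDistrib X (-X) P P) {b : ℝ} (hb : 0 < b)
    (h : Integrable (fun ω => Real.exp (b * X ω ^ 2)) P)
    (hzero : ∀ z, complexMGF X P z = 0 → z.re = 0) {s t : ℝ} (hs : 0 < s) (hst : s ≤ t) :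
    mgf X P t ≤ mgf X P s ^ (t ^ 2 / s ^ 2) := by
  have hX : AEMeasurable X P := hsymm.aemeasurable_fst
  have hint := integrable_exp_mul_of_integrable_exp_mul_sq hX hb h
  set M := ∫ ω, Real.exp (b * X ω ^ 2) ∂P with hM
  have hM0 : 0 ≤ M := integral_nonneg fun _ => (Real.exp_pos _).le
  have key := norm_le_rpow_of_imaginary_zeros (differentiable_complexMGF hint)
    (complexMGF_neg_of_symm hsymm) (by simp [complexMGF]) hzero
    -- On |z| = 2R the exponent (Re z)²/(4b) is at most R²/b, and M ≤ exp(M R²) because R ≥ 1.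
    (B := 1 / b + M) (by positivity) (fun R hR z hz => ?_) hs hst
  · simpa only [complexMGF_ofReal, Complex.norm_real, Real.norm_of_nonneg mgf_nonneg] using key
  · calc ‖complexMGF X P z‖ ≤ mgf X P z.re := norm_complexMGF_le_mgf
      _ ≤ Real.exp (z.re ^ 2 / (4 * b)) * M := mgf_le_exp_sq_mul_integral hX hb h _
      _ ≤ Real.exp (1 / b * R ^ 2) * Real.exp (M * R ^ 2) := by
        gcongr
        · have h1 : z.re ^ 2 ≤ (2 * R) ^ 2 := by
            rw [← hz]
            exact sq_le_sq.2 ((Complex.abs_re_le_norm z).trans (le_abs_self _))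
          calc z.re ^ 2 / (4 * b) ≤ (2 * R) ^ 2 / (4 * b) := by gcongr
            _ = 1 / b * R ^ 2 := by field_simp; ring
        · have h1 : M ≤ M * R ^ 2 := le_mul_of_one_le_right hM0 (one_le_pow₀ hR)
          linarith [Real.add_one_le_exp (M * R ^ 2)]
      _ = Real.exp ((1 / b + M) * R ^ 2) := by rw [← Real.exp_add, add_mul]

/-- A bound for the moment generating function at a point determined by tightness. -/
theorem mgf_le_two_of_tail_lt [IsProbabilityMeasure P] (hX : AEMeasurable X P)
    (hint : ∀ t, Integrable (fun ω => Real.exp (t * X ω)) P)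
    (hmono : ∀ s : ℝ, 0 < s → mgf X P (2 * s) ≤ mgf X P s ^ 4)
    {K : ℝ} (hK : 0 < K) (htail : P.real {ω | K ≤ |X ω|} < 1 / 64) :
    mgf X P (1 / (4 * K)) ≤ 2 := by
  by_contra! hcon
  have hK4 : 0 < 1 / (4 * K) := by positivity
  obtain ⟨s, hs, hs2⟩ := intermediate_value_Icc hK4.le (continuous_mgf hint).continuousOn
    (show (2 : ℝ) ∈ Set.Icc (mgf X P 0) (mgf X P (1 / (4 * K))) by
      rw [mgf_zero]; exact ⟨by norm_num, hcon.le⟩)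
  have hs0 : 0 < s := by
    rcases hs.1.eq_or_lt with rfl | h
    · norm_num [mgf_zero] at hs2
    · exact h
  have h16 : mgf X P (2 * s) ≤ 16 := by
    have := hmono s hs0
    rw [hs2] at this
    linarith
  have hnull : NullMeasurableSet {ω | K ≤ |X ω|} P :=
    nullMeasurableSet_le aemeasurable_const (continuous_abs.measurable.comp_aemeasurable hX)
  have hind : Integrable ({ω | K ≤ |X ω|}.indicator fun _ => (1 : ℝ)) P :=
    (integrable_const 1).indicator₀ hnull
  have hsum : Integrable (fun ω => 1 / 64 * Real.exp (2 * s * X ω) +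
      16 * {ω | K ≤ |X ω|}.indicator (fun _ => (1 : ℝ)) ω) P :=
    ((hint (2 * s)).const_mul _).add (hind.const_mul _)
  -- Off the tail sX ≤ 1/4 and exp(sX) ≤ 3/2; on it y ≤ y²/64 + 16 with y = exp(sX). Integrating
  -- gives 2 < 3/2 + 16/64 + 16/64 = 2.
  have hle : mgf X P s ≤ ∫ ω, (3 / 2 + (1 / 64 * Real.exp (2 * s * X ω) +
      16 * {ω | K ≤ |X ω|}.indicator (fun _ => (1 : ℝ)) ω)) ∂P := by
    refine integral_mono (hint s) ((integrable_const _).add hsum) fun ω => ?_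
    have hsq : Real.exp (2 * s * X ω) = Real.exp (s * X ω) ^ 2 := by
      rw [← Real.exp_nat_mul]; push_cast; ring_nf
    simp only [hsq]
    by_cases hω : K ≤ |X ω|
    · rw [Set.indicator_of_mem (by exact hω)]
      nlinarith [sq_nonneg (Real.exp (s * X ω) / 8 - 4)]
    · rw [Set.indicator_of_notMem (by exact hω)]
      have h1 : s * X ω ≤ 1 / 4 := by
        have h2 : X ω ≤ K := (le_abs_self _).trans (not_le.1 hω).le
        calc s * X ω ≤ s * K := by gcongr
          _ ≤ 1 / (4 * K) * K := by gcongr; exact hs.2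
          _ = 1 / 4 := by field_simp
      have h3 : Real.exp (s * X ω) ≤ 3 / 2 := by
        have h4 := Real.add_one_le_exp (-(s * X ω))
        rw [Real.exp_neg] at h4
        have h5 := Real.exp_pos (s * X ω)
        have h6 : (3 / 4 : ℝ) ≤ (Real.exp (s * X ω))⁻¹ := by linarith
        have h7 := mul_le_mul_of_nonneg_left h6 h5.le
        rw [mul_inv_cancel₀ h5.ne'] at h7
        linarith
      nlinarith [sq_nonneg (Real.exp (s * X ω))]
  rw [integral_add (integrable_const _) hsum, integral_add ((hint (2 * s)).const_mul _) (hind.const_mul _), integral_const_mul,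
    integral_const_mul, integral_indicator₀ hnull] at hle
  simp only [integral_const, probReal_univ, smul_eq_mul, one_mul, mul_one,
    measureReal_restrict_apply_univ] at hle
  have h2s : ∫ ω, Real.exp (2 * s * X ω) ∂P = mgf X P (2 * s) := rfl
  rw [h2s] at hle
  linarith

/-- Beyond s use 2 ≤ e; for 0 ≤ t ≤ s use exp(tX) ≤ 1 + exp(sX), whose mean is at most 3; symmetry
covers t < 0. -/
theorem mgf_le_of_le_rpow [IsProbabilityMeasure P] (hsymm : IdentDistrib X (-X) P P)
    (hint : ∀ t, Integrable (fun ω => Real.exp (t * X ω)) P)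
    {s : ℝ} (hs : 0 < s) (h2 : mgf X P s ≤ 2)
    (hmono : ∀ t : ℝ, s ≤ t → mgf X P t ≤ mgf X P s ^ (t ^ 2 / s ^ 2)) (t : ℝ) :
    mgf X P t ≤ 3 * Real.exp (1 / s ^ 2 * t ^ 2) := by
  wlog ht : 0 ≤ t generalizing t
  · have h := this (-t) (by linarith)
    rw [← mgf_neg, ← mgf_congr_identDistrib hsymm] at h
    simpa using h
  rcases le_total s t with hst | hst
  · calc mgf X P t ≤ mgf X P s ^ (t ^ 2 / s ^ 2) := hmono t hst
      _ ≤ Real.exp 1 ^ (t ^ 2 / s ^ 2) := by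
        have := Real.add_one_le_exp 1
        gcongr
        · exact mgf_nonneg
        · linarith
      _ = Real.exp (1 / s ^ 2 * t ^ 2) := by
        rw [← Real.exp_mul]; congr 1; ring
      _ ≤ 3 * Real.exp (1 / s ^ 2 * t ^ 2) := by linarith [Real.exp_pos (1 / s ^ 2 * t ^ 2)]
  · have h3 : mgf X P t ≤ ∫ ω, (1 + Real.exp (s * X ω)) ∂P := by
      refine integral_mono (hint t) ((integrable_const _).add (hint s)) fun ω => ?_
      simp only
      rcases le_total 0 (X ω) with h | h
      · have : Real.exp (t * X ω) ≤ Real.exp (s * X ω) := by gcongr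
        linarith
      · have : Real.exp (t * X ω) ≤ 1 :=
          Real.exp_le_one_iff.2 (mul_nonpos_of_nonneg_of_nonpos ht h)
        linarith [Real.exp_pos (s * X ω)]
    rw [integral_add (integrable_const _) (hint s)] at h3
    simp only [integral_const, probReal_univ, smul_eq_mul, one_mul] at h3
    change _ ≤ 1 + mgf X P s at h3
    have := Real.add_one_le_exp (1 / s ^ 2 * t ^ 2)
    have h5 : 0 ≤ 1 / s ^ 2 * t ^ 2 := by positivity
    linarith

theorem lintegral_ofReal_mul_exp_neg_mul_sq {c : ℝ} (hc : 0 < c) {C : ℝ} (hC : 0 ≤ C) :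
    ∫⁻ s : ℝ, ENNReal.ofReal (C * Real.exp (-c * s ^ 2)) =
      ENNReal.ofReal (C * √(Real.pi / c)) := by
  rw [← integral_gaussian, ← integral_const_mul, ofReal_integral_eq_lintegral_ofReal
    ((integrable_exp_neg_mul_sq hc).const_mul C) (ae_of_all _ fun _ => by positivity)]

/-- A Gaussian bound for the moment generating function gives a bound for the exponential moment
of the square, uniform in the random variable. -/
theorem lintegral_exp_sq_le_of_mgf_le [IsProbabilityMeasure P] (hX : AEMeasurable X P)
    (hint : ∀ t, Integrable (fun ω => Real.exp (t * X ω)) P)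
    {a C : ℝ} (ha : 0 < a) (hC : 0 ≤ C) (hmgf : ∀ t, mgf X P t ≤ C * Real.exp (a * t ^ 2)) :
    ∫⁻ ω, ENNReal.ofReal (Real.exp (1 / (8 * a) * X ω ^ 2)) ∂P ≤ ENNReal.ofReal (C * √2) := by
  set c := ∫⁻ s : ℝ, ENNReal.ofReal (1 * Real.exp (-(2 * a) * s ^ 2)) with hc
  have hc' : c = ENNReal.ofReal √(Real.pi / (2 * a)) := by
    rw [hc, lintegral_ofReal_mul_exp_neg_mul_sq (by positivity) zero_le_one, one_mul]
  have hctop : c ≠ ⊤ := hc' ▸ ENNReal.ofReal_ne_top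
  have hc0 : c ≠ 0 := by
    rw [hc', Ne, ENNReal.ofReal_eq_zero, not_le]
    exact Real.sqrt_pos.2 (div_pos Real.pi_pos (by positivity))
  have hCc : ENNReal.ofReal (C * √2) * c =
      ∫⁻ s : ℝ, ENNReal.ofReal (C * Real.exp (-a * s ^ 2)) := by
    rw [lintegral_ofReal_mul_exp_neg_mul_sq ha hC, hc', ← ENNReal.ofReal_mul (by positivity),
      mul_assoc, ← Real.sqrt_mul (by norm_num)]
    congr 3
    field_simp
  refine (ENNReal.mul_le_mul_iff_left hc0 hctop).1 ?_
  rw [hCc, ← lintegral_mul_const' _ _ hctop]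
  -- Completing the square writes exp(x²/(8a)) as a Gaussian average of exp(sx). The weight
  -- exp(-2as²) still leaves exp(-as²) after the bound on the transform, and √2 is the ratio of the
  -- two Gaussian integrals.
  have hω : ∀ x : ℝ, ENNReal.ofReal (Real.exp (1 / (8 * a) * x ^ 2)) * c =
      ∫⁻ s : ℝ, ENNReal.ofReal (Real.exp (s * x) * Real.exp (-(2 * a) * s ^ 2)) := fun x => by
    rw [hc, ← lintegral_sub_right_eq_self _ (x / (4 * a)),
      ← lintegral_const_mul' _ _ ENNReal.ofReal_ne_top]
    refine lintegral_congr fun s => ?_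
    rw [← ENNReal.ofReal_mul (Real.exp_pos _).le, one_mul, ← Real.exp_add, ← Real.exp_add]
    congr 2
    field_simp
    ring
  simp_rw [hω]
  rw [lintegral_lintegral_swap]
  · refine lintegral_mono fun s => ?_
    rw [← ofReal_integral_eq_lintegral_ofReal ((hint s).mul_const _)
      (ae_of_all _ fun _ => by positivity), integral_mul_const]
    refine ENNReal.ofReal_le_ofReal ?_
    calc _ ≤ C * Real.exp (a * s ^ 2) * Real.exp (-(2 * a) * s ^ 2) := by
          gcongr; exact hmgf s
      _ = C * Real.exp (-a * s ^ 2) := by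
          rw [mul_assoc, ← Real.exp_add]; congr 2; ring
  · refine ENNReal.measurable_ofReal.comp_aemeasurable (AEMeasurable.mul ?_ ?_)
    · exact Real.measurable_exp.comp_aemeasurable
        (measurable_snd.aemeasurable.mul hX.comp_fst)
    · exact (by fun_prop : Measurable fun p : Ω × ℝ =>
        Real.exp (-(2 * a) * p.2 ^ 2)).aemeasurable

end Mgf

/-! ### Tightness and passage to the limit -/

theorem exists_pos_tail_lt {Ω : Type*} [MeasurableSpace Ω] (P : Measure Ω)
    [IsProbabilityMeasure P] {Y : Ω → ℝ} (hY : AEMeasurable Y P) {ε : ENNReal} (hε : 0 < ε) :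
    ∃ K : ℝ, 0 < K ∧ P.map Y {x | K ≤ |x|} < ε := by
  have := Measure.isProbabilityMeasure_map hY
  have h := tendsto_measure_norm_gt_of_isTightMeasureSet
    (isTightMeasureSet_singleton (μ := P.map Y))
  simp only [Set.mem_singleton_iff, iSup_iSup_eq_left] at h
  obtain ⟨K, hK, hK0⟩ := ((h.eventually_lt_const hε).and (eventually_gt_atTop 0)).exists
  refine ⟨K + 1, by positivity, (measure_mono fun x hx => ?_).trans_lt hK⟩
  have : K + 1 ≤ |x| := hx
  simp only [Set.mem_ofPred_eq, Real.norm_eq_abs]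
  linarith

theorem mainTheorem7
    {Ω : ℕ → Type*} {Ω' : Type*}
    [∀ n, MeasurableSpace (Ω n)] [MeasurableSpace Ω']
    (P : ∀ n, Measure (Ω n)) [∀ n, IsProbabilityMeasure (P n)]
    (P' : Measure Ω') [IsProbabilityMeasure P']
    (X : ∀ n, Ω n → ℝ) (Y : Ω' → ℝ)
    (hsymm : ∀ n, IdentDistrib (X n) (-X n) (P n) (P n))
    (hsub : ∀ n, ∃ b : ℝ, 0 < b ∧
      ∫⁻ ω, ENNReal.ofReal (Real.exp (b * X n ω ^ 2)) ∂(P n) < ⊤)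
    (hlim : TendstoInDistribution X atTop Y P P')
    (hY : ∀ b : ℝ, 0 < b →
      ∫⁻ ω, ENNReal.ofReal (Real.exp (b * Y ω ^ 2)) ∂P' = ⊤) :
    ∀ᶠ n in atTop, ∃ z : ℂ, z.re ≠ 0 ∧
      Integrable (fun ω => Complex.exp (z * (X n ω : ℂ))) (P n) ∧
      complexMGF (X n) (P n) z = 0 := by
  by_contra hcon
  rw [not_eventually] at hcon
  have hXm := hlim.forall_aemeasurable
  have hYm := hlim.aemeasurable_limit
  obtain ⟨K, hK, hKY⟩ := exists_pos_tail_lt P' hYm (ε := ENNReal.ofReal (1 / 64)) (by simp)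
  have hclosed : IsClosed {x : ℝ | K ≤ |x|} := isClosed_le continuous_const continuous_abs
  have htail : ∀ᶠ n in atTop, (P n).map (X n) {x | K ≤ |x|} < ENNReal.ofReal (1 / 64) :=
    eventually_lt_of_limsup_lt
      ((ProbabilityMeasure.limsup_measure_closed_le_of_tendsto hlim.tendsto hclosed).trans_lt hKY)
  set s := 1 / (4 * K) with hs
  have hs0 : 0 < s := by positivity
  set a := 1 / s ^ 2 with ha
  have ha0 : 0 < a := by positivity
  have hcont : Continuous fun x : ℝ => Real.exp (1 / (8 * a) * x ^ 2) := by fun_prop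
  -- Both the exponent and the bound depend only on K, hence not on n; a bound for infinitely many n
  -- suffices, since only a liminf is needed.
  have hfreq : ∃ᶠ n in atTop,
      ∫⁻ x, ENNReal.ofReal (Real.exp (1 / (8 * a) * x ^ 2)) ∂((P n).map (X n)) ≤
        ENNReal.ofReal (3 * √2) := by
    refine (hcon.and_eventually htail).mono fun n hn => ?_
    obtain ⟨hn, hnt⟩ := hn
    obtain ⟨b, hb, hbX⟩ := hsub n
    have hb2 := integrable_exp_mul_sq_of_lintegral_lt_top (hXm n) hbX
    have hint := integrable_exp_mul_of_integrable_exp_mul_sq (hXm n) hb hb2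
    have hzero : ∀ z, complexMGF (X n) (P n) z = 0 → z.re = 0 := fun z hz => by
      by_contra hre
      exact hn ⟨z, hre, integrable_cexp_mul (hXm n) hint z, hz⟩
    have hmono {u t : ℝ} (hu : 0 < u) (hut : u ≤ t) :=
      mgf_le_rpow_of_imaginary_zeros (hsymm n) hb hb2 hzero hu hut
    have h2 : mgf (X n) (P n) s ≤ 2 := by
      refine mgf_le_two_of_tail_lt (hXm n) hint (fun u hu => ?_) hK ?_
      · have h := hmono hu (show u ≤ 2 * u by linarith)
        have h4 : (2 * u) ^ 2 / u ^ 2 = (4 : ℕ) := by push_cast; field_simp; norm_num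
        rwa [h4, Real.rpow_natCast] at h
      · rw [Measure.map_apply_of_aemeasurable (hXm n) hclosed.measurableSet] at hnt
        exact (ENNReal.lt_ofReal_iff_toReal_lt (measure_ne_top _ _)).1 hnt
    rw [lintegral_map' (by fun_prop) (hXm n)]
    exact lintegral_exp_sq_le_of_mgf_le (hXm n) hint ha0 (by norm_num)
      (mgf_le_of_le_rpow (hsymm n) hint hs0 h2 fun t ht => hmono hs0 ht)
  have hle := lintegral_le_liminf_lintegral_of_forall_isOpen_measure_le_liminf_measure hcont
    (fun _ => (Real.exp_pos _).le) fun G hG =>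
      ProbabilityMeasure.le_liminf_measure_open_of_tendsto hlim.tendsto hG
  have hle2 := hle.trans (liminf_le_of_frequently_le hfreq)
  simp only [ProbabilityMeasure.coe_mk] at hle2
  rw [lintegral_map' (by fun_prop) hYm, hY _ (by positivity)] at hle2
  exact ENNReal.ofReal_lt_top.not_ge hle2
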